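/- Let $\mathcal C$ be a regular category (finite limits, coequalisers of kernel pairs, regular epimorphisms stable under pullback), and let $\mathcal S$ be the class of regular epimorphisms of $\mathcal C$. Then $$\mathsf{Span}^{\mathcal S}(\mathcal C)\;\cong\;\mathsf{Rel}(\mathcal C)$$ as cartesian bicategories. Here: * A cartesian bicategory is a poset-enriched symmetric monoidal category in which every object $X$ carries a cocommutative comonoid $(X\to X\otimes X,\ X\to I)$, compatible with $\otimes$ and $I$, whose two structure maps have right adjoints $X\otimes X\to X$ and $I\to X$ satisfying the Frobenius law, and in which every morphism is a lax comonoid homomorphism. A morphism of cartesian bicategories is a (strong, symmetric) monoidal functor preserving the ordering and the chosen comonoids and monoids, and $\cong$ means that there are two mutually inverse such morphisms. * $\mathsf{Span}^{\mathcal S}(\mathcal C)$ has the objects of $\mathcal C$. For spans from $X$ to $Y$ put $(X\xleftarrow{f}A\xrightarrow{g}Y)\le(X\xleftarrow{h}B\xrightarrow{k}Y)$ if there are an object $A'$, a morphism $\pi\colon A'\to A$ in $\mathcal S$ and a morphism $\alpha\colon A'\to B$ with $f\circ\pi=h\circ\alpha$ and $g\circ\pi=k\circ\alpha$. Morphisms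 $X\to Y$ are spans modulo the equivalence relation $s\le t\le s$, ordered by $\le$; composition is by weak pullback (the equivalence class does not depend on the choice), and identities are the identity spans. * $\mathsf{Rel}(\mathcal C)$ has the objects of $\mathcal C$. Morphisms $X\to Y$ are (isomorphism classes of) jointly monic spans, i.e. spans $X\xleftarrow{f}A\xrightarrow{g}Y$ with $\langle f,g\rangle\colon A\to X\times Y$ monic, ordered by existence of a morphism of spans. The composite of two jointly monic spans is the image of their composite by pullback, where the image of a span is the jointly monic span given by the (regular epi, mono)-factorisation of $\langle f,g\rangle$; identities are the identity spans. * In both, the monoidal product is given by the product of $\mathcal C$, with unit the terminal object $1$; the comonoid on $X$ is given by the spans $X\xleftarrow{\mathrm{id}}X\xrightarrow{\Delta}X\times X$ and $X\xleftarrow{\mathrm{id}}X\xrightarrow{!}1$, and the monoid by the opposite spans. -/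

import Mathlib

open CategoryTheory MonoidalCategory CartesianMonoidalCategory Limits

set_option linter.unusedSectionVars false

universe v v₁ v₂ v₃ u u₁ u₂ u₃

namespace CartBicat

/-! ### Cartesian bicategories and their morphisms -/

/-- A cartesian bicategory (poset-enriched, "of relations"): a symmetric monoidal category enriched
over posets in which every object has a cocommutative comonoid structure, coherent with `⊗`
(the superclass `CopyDiscardCategory`), whose structure maps have right adjoints satisfying the
Frobenius law, and for which every morphism is a lax comonoid homomorphism. -/
class CartesianBicategory (B : Type u) [Category.{v} B] [MonoidalCategory B]
    extends CopyDiscardCategory B where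
  [homOrder : ∀ X Y : B, PartialOrder (X ⟶ Y)]
  comp_mono : ∀ {X Y Z : B} {R R' : X ⟶ Y} {T T' : Y ⟶ Z}, R ≤ R' → T ≤ T' → R ≫ T ≤ R' ≫ T'
  tensor_mono : ∀ {X Y Z W : B} {R R' : X ⟶ Y} {T T' : Z ⟶ W},
    R ≤ R' → T ≤ T' → (R ⊗ₘ T) ≤ (R' ⊗ₘ T')
  cocopy : ∀ X : B, X ⊗ X ⟶ X
  codiscard : ∀ X : B, 𝟙_ B ⟶ X
  copy_unit_le : ∀ X : B, 𝟙 X ≤ ComonObj.comul (X := X) ≫ cocopy X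
  copy_counit_le : ∀ X : B, cocopy X ≫ ComonObj.comul (X := X) ≤ 𝟙 (X ⊗ X)
  discard_unit_le : ∀ X : B, 𝟙 X ≤ ComonObj.counit (X := X) ≫ codiscard X
  discard_counit_le : ∀ X : B, codiscard X ≫ ComonObj.counit (X := X) ≤ 𝟙 (𝟙_ B)
  frobenius_left : ∀ X : B,
    (ComonObj.comul (X := X) ▷ X) ≫ (α_ X X X).hom ≫ (X ◁ cocopy X) =
      cocopy X ≫ ComonObj.comul (X := X)
  frobenius_right : ∀ X : B,
    (X ◁ ComonObj.comul (X := X)) ≫ (α_ X X X).inv ≫ (cocopy X ▷ X) =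
      cocopy X ≫ ComonObj.comul (X := X)
  lax_copy : ∀ {X Y : B} (R : X ⟶ Y),
    R ≫ ComonObj.comul (X := Y) ≤ ComonObj.comul (X := X) ≫ (R ⊗ₘ R)
  lax_discard : ∀ {X Y : B} (R : X ⟶ Y),
    R ≫ ComonObj.counit (X := Y) ≤ ComonObj.counit (X := X)

attribute [reducible] CartesianBicategory.homOrder
attribute [instance] CartesianBicategory.homOrder

section Morphisms

open Functor.LaxMonoidal Functor.OplaxMonoidal CartesianBicategory

variable (B : Type u) [Category.{v} B] [MonoidalCategory B] [CartesianBicategory B]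
  (B₁ : Type u₁) [Category.{v₁} B₁] [MonoidalCategory B₁] [CartesianBicategory B₁]
  (B₂ : Type u₂) [Category.{v₂} B₂] [MonoidalCategory B₂] [CartesianBicategory B₂]

/-- A morphism of cartesian bicategories: a (strong, symmetric) monoidal functor that preserves the
ordering and the chosen comonoids and monoids. -/
structure CBFunctor where
  toFunctor : B₁ ⥤ B₂
  [braided : toFunctor.Braided]
  monotone : ∀ {X Y : B₁} {R T : X ⟶ Y}, R ≤ T → toFunctor.map R ≤ toFunctor.map T
  map_copy : ∀ X : B₁, toFunctor.map (ComonObj.comul (X := X)) =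
    ComonObj.comul (X := toFunctor.obj X) ≫ μ toFunctor X X
  map_discard : ∀ X : B₁, toFunctor.map (ComonObj.counit (X := X)) =
    ComonObj.counit (X := toFunctor.obj X) ≫ ε toFunctor
  map_cocopy : ∀ X : B₁, μ toFunctor X X ≫ toFunctor.map (cocopy X) = cocopy (toFunctor.obj X)
  map_codiscard : ∀ X : B₁, ε toFunctor ≫ toFunctor.map (codiscard X) = codiscard (toFunctor.obj X)

attribute [instance] CBFunctor.braided

variable {B₁ B₂} in
/-- The identity morphism of a cartesian bicategory. -/
def CBFunctor.id : CBFunctor B B where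
  toFunctor := 𝟭 B
  monotone h := h
  map_copy X := by simp
  map_discard X := by simp
  map_cocopy X := by simp
  map_codiscard X := by simp

variable {B B₁ B₂} in
/-- Composition of morphisms of cartesian bicategories. -/
def CBFunctor.comp (F : CBFunctor B B₁) (G : CBFunctor B₁ B₂) : CBFunctor B B₂ where
  toFunctor := F.toFunctor ⋙ G.toFunctor
  monotone h := G.monotone (F.monotone h)
  map_copy X := by simp [F.map_copy, G.map_copy]
  map_discard X := by simp [F.map_discard, G.map_discard]
  map_cocopy X := by
    have h := G.map_cocopy (F.toFunctor.obj X)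
    rw [← F.map_cocopy] at h
    simpa using h
  map_codiscard X := by
    have h := G.map_codiscard (F.toFunctor.obj X)
    rw [← F.map_codiscard] at h
    simpa using h

/-- An isomorphism of cartesian bicategories: a pair of mutually inverse morphisms. The equations
are equalities of morphisms of cartesian bicategories, so they include the monoidal structure. -/
structure CBIso where
  hom : CBFunctor B₁ B₂
  inv : CBFunctor B₂ B₁
  hom_inv_id : hom.comp inv = CBFunctor.id B₁
  inv_hom_id : inv.comp hom = CBFunctor.id B₂

end Morphisms

/-! ### Spans and systems of covers -/

section Spans

variable {C : Type u} [Category.{v} C]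

/-- Spans `X ⟵ A ⟶ Y` in `C`, with no condition on the legs. -/
abbrev Sp (X Y : C) : Type (max u v) := Span (⊤ : MorphismProperty C) (⊤ : MorphismProperty C) X Y

namespace Sp

/-- The span with given legs. -/
abbrev mk {X Y A : C} (l : A ⟶ X) (r : A ⟶ Y) : Sp X Y := ⟨A, l, r, trivial, trivial⟩

/-- The graph `X ⟵ X ⟶ Y` of a morphism, with left leg the identity. -/
abbrev graph {X Y : C} (f : X ⟶ Y) : Sp X Y := mk (𝟙 X) f

/-- The opposite `Y ⟵ X ⟶ X` of the graph of a morphism. -/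
abbrev cograph {X Y : C} (f : X ⟶ Y) : Sp Y X := mk f (𝟙 X)

/-- The composite of two spans, computed by a weak pullback. -/
noncomputable abbrev comp [HasWeakPullbacks C] {X Y Z : C} (s : Sp X Y) (t : Sp Y Z) : Sp X Z :=
  mk (weakPullback.fst s.r t.l ≫ s.l) (weakPullback.snd s.r t.l ≫ t.r)

/-- The product of two spans. -/
abbrev tensor [CartesianMonoidalCategory C] {X Y Z W : C} (s : Sp X Y) (t : Sp Z W) :
    Sp (X ⊗ Z) (Y ⊗ W) :=
  mk (s.l ⊗ₘ t.l) (s.r ⊗ₘ t.r)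

/-- A pair of generalised elements `x`, `y` is related by the span `s` if it factors through the
apex (auxiliary, used only to verify laws). -/
def Mem {X Y U : C} (s : Sp X Y) (x : U ⟶ X) (y : U ⟶ Y) : Prop :=
  ∃ a : U ⟶ s.apex, a ≫ s.l = x ∧ a ≫ s.r = y

@[simp] lemma mem_graph {X Y U : C} (f : X ⟶ Y) (x : U ⟶ X) (y : U ⟶ Y) :
    (graph f).Mem x y ↔ x ≫ f = y := by
  simp [Mem]

@[simp] lemma mem_cograph {X Y U : C} (f : X ⟶ Y) (x : U ⟶ Y) (y : U ⟶ X) :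
    (cograph f).Mem x y ↔ y ≫ f = x := by
  simp [Mem]

@[simp] lemma mem_comp [HasWeakPullbacks C] {X Y Z U : C} (s : Sp X Y) (t : Sp Y Z)
    (x : U ⟶ X) (z : U ⟶ Z) : (s.comp t).Mem x z ↔ ∃ y, s.Mem x y ∧ t.Mem y z := by
  constructor
  · rintro ⟨a, rfl, rfl⟩
    exact ⟨a ≫ weakPullback.fst s.r t.l ≫ s.r, ⟨a ≫ weakPullback.fst s.r t.l, by simp [comp]⟩,
      ⟨a ≫ weakPullback.snd s.r t.l, by simp [comp, weakPullback.condition]⟩⟩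
  · rintro ⟨y, ⟨a, rfl, rfl⟩, b, h, rfl⟩
    obtain ⟨c, rfl, rfl⟩ := weakPullback.exists_lift s.r t.l a b h.symm
    exact ⟨c, by simp [comp]⟩

@[simp] lemma mem_tensor [CartesianMonoidalCategory C] {X Y Z W U : C} (s : Sp X Y) (t : Sp Z W)
    (x : U ⟶ X ⊗ Z) (y : U ⟶ Y ⊗ W) : (s.tensor t).Mem x y ↔
      s.Mem (x ≫ fst _ _) (y ≫ fst _ _) ∧ t.Mem (x ≫ snd _ _) (y ≫ snd _ _) := by
  constructor
  · rintro ⟨a, rfl, rfl⟩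
    exact ⟨⟨a ≫ fst _ _, by simp [tensor]⟩, ⟨a ≫ snd _ _, by simp [tensor]⟩⟩
  · rintro ⟨⟨a, h₁, h₂⟩, b, h₃, h₄⟩
    refine ⟨lift a b, ?_, ?_⟩ <;> ext <;> simp [tensor, h₁, h₂, h₃, h₄]

lemma Mem.precomp {X Y U V : C} {s : Sp X Y} {x : U ⟶ X} {y : U ⟶ Y} (h : s.Mem x y)
    (u : V ⟶ U) : s.Mem (u ≫ x) (u ≫ y) := by
  obtain ⟨a, rfl, rfl⟩ := h
  exact ⟨u ≫ a, by simp⟩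

lemma mem_legs {X Y : C} (s : Sp X Y) : s.Mem s.l s.r := ⟨𝟙 _, by simp⟩

end Sp

/-- A system of covers in a category with (chosen) finite products: a class of morphisms that
contains the identities, is closed under composition, products and weak pullbacks, and contains `π`
whenever it contains some composite "first `f`, then `π`". -/
class IsSystemOfCovers [CartesianMonoidalCategory C] (S : MorphismProperty C) : Prop where
  id_mem : ∀ X : C, S (𝟙 X)
  comp_mem : ∀ {X Y Z : C} (f : X ⟶ Y) (g : Y ⟶ Z), S f → S g → S (f ≫ g)
  prod_mem : ∀ {X Y Z W : C} (f : X ⟶ Y) (g : Z ⟶ W), S f → S g → S (f ⊗ₘ g)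
  weakPullback_mem : ∀ {X Y Z : C} {f : X ⟶ Z} {π : Y ⟶ Z} (c : PullbackCone f π),
    IsWeakLimit c → S π → S c.fst
  of_comp_mem : ∀ {X Y Z : C} (f : X ⟶ Y) (π : Y ⟶ Z), S (f ≫ π) → S π

namespace Sp

variable (S : MorphismProperty C)

/-- The ordering of spans determined by a class `S` of covers: `s ≤ t` if there are a cover
`π : A' ⟶ A` of the apex of `s` and a morphism `α : A' ⟶ B` to the apex of `t`, compatible with the
legs. -/
def Le {X Y : C} (s t : Sp X Y) : Prop :=
  ∃ (A' : C) (π : A' ⟶ s.apex) (α : A' ⟶ t.apex),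
    S π ∧ π ≫ s.l = α ≫ t.l ∧ π ≫ s.r = α ≫ t.r

variable {S}

lemma le_iff {X Y : C} {s t : Sp X Y} :
    Le S s t ↔ ∃ (A' : C) (π : A' ⟶ s.apex), S π ∧ t.Mem (π ≫ s.l) (π ≫ s.r) := by
  constructor
  · rintro ⟨A', π, α, h, h₁, h₂⟩
    exact ⟨A', π, h, α, h₁.symm, h₂.symm⟩
  · rintro ⟨A', π, h, α, h₁, h₂⟩
    exact ⟨A', π, α, h, h₁.symm, h₂.symm⟩

variable [CartesianMonoidalCategory C] [IsSystemOfCovers S]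

lemma le_of_mem {X Y : C} {s t : Sp X Y}
    (h : ∀ {U : C} (x : U ⟶ X) (y : U ⟶ Y), s.Mem x y → t.Mem x y) : Le S s t :=
  le_iff.2 ⟨_, 𝟙 _, IsSystemOfCovers.id_mem _, by simpa using h _ _ s.mem_legs⟩

lemma le_refl {X Y : C} (s : Sp X Y) : Le S s s := le_of_mem fun _ _ h => h

variable [HasWeakPullbacks C]

lemma Le.lift {X Y U : C} {s t : Sp X Y} (h : Le S s t) {x : U ⟶ X} {y : U ⟶ Y}
    (hs : s.Mem x y) : ∃ (V : C) (p : V ⟶ U), S p ∧ t.Mem (p ≫ x) (p ≫ y) := by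
  obtain ⟨A', π, hπ, ht⟩ := le_iff.1 h
  obtain ⟨a, rfl, rfl⟩ := hs
  refine ⟨_, weakPullback.fst a π, IsSystemOfCovers.weakPullback_mem _
    (weakPullback.isWeakLimit a π) hπ, ?_⟩
  have := ht.precomp (weakPullback.snd a π)
  simpa [← weakPullback.condition_assoc] using this

lemma Le.trans {X Y : C} {s t w : Sp X Y} (h : Le S s t) (h' : Le S t w) : Le S s w := by
  obtain ⟨A', π, hπ, ht⟩ := le_iff.1 h
  obtain ⟨V, p, hp, hw⟩ := h'.lift ht
  exact le_iff.2 ⟨V, p ≫ π, IsSystemOfCovers.comp_mem _ _ hp hπ, by simpa using hw⟩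

lemma Le.comp {X Y Z : C} {s s' : Sp X Y} {t t' : Sp Y Z} (h : Le S s s') (h' : Le S t t') :
    Le S (s.comp t) (s'.comp t') := by
  obtain ⟨y, hs, ht⟩ := (mem_comp _ _ _ _).1 (s.comp t).mem_legs
  obtain ⟨V, p, hp, hs'⟩ := h.lift hs
  obtain ⟨W, q, hq, ht'⟩ := h'.lift (ht.precomp p)
  refine le_iff.2 ⟨W, q ≫ p, IsSystemOfCovers.comp_mem _ _ hq hp, (mem_comp _ _ _ _).2
    ⟨q ≫ p ≫ y, ?_, by simpa using ht'⟩⟩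
  simpa using hs'.precomp q

lemma Le.tensor {X Y Z W : C} {s s' : Sp X Y} {t t' : Sp Z W} (h : Le S s s')
    (h' : Le S t t') : Le S (s.tensor t) (s'.tensor t') := by
  obtain ⟨A, π, α, hπ, h₁, h₂⟩ := h
  obtain ⟨B, ρ, β, hρ, h₃, h₄⟩ := h'
  refine ⟨A ⊗ B, π ⊗ₘ ρ, α ⊗ₘ β, IsSystemOfCovers.prod_mem _ _ hπ hρ, ?_, ?_⟩ <;>
    simp [Sp.tensor, h₁, h₂, h₃, h₄]

variable (S) in
/-- The equivalence relation `s ≤ t ≤ s` on spans. -/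
def setoid (X Y : C) : Setoid (Sp X Y) where
  r s t := Le S s t ∧ Le S t s
  iseqv := ⟨fun s => ⟨le_refl s, le_refl s⟩, fun h => ⟨h.2, h.1⟩,
    fun h h' => ⟨h.1.trans h'.1, h'.2.trans h.2⟩⟩

end Sp

/-- The objects of `Span^S(C)`: those of `C`. -/
structure SpanS (S : MorphismProperty C) where of ::
  as : C

end Spans

/-! ### The cartesian bicategory `Span^S(C)`

Objects are those of `C`, morphisms are spans modulo `s ≤ t ≤ s`, composition is by weak pullback,
the monoidal product is the product of `C`; copying and discarding are the graphs of the diagonal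
and of the map to the terminal object, and their right adjoints are the opposite spans. -/

namespace SpanS

variable {C : Type u} [Category.{v} C] [CartesianMonoidalCategory C]
  [HasWeakPullbacks C] {S : MorphismProperty C} [IsSystemOfCovers S]

/-- Morphisms of `Span^S(C)`: equivalence classes of spans. -/
def Hom (X Y : SpanS S) : Type (max u v) := Quotient (Sp.setoid S X.as Y.as)

/-- The class of a span. -/
def Hom.mk {X Y : SpanS S} (s : Sp X.as Y.as) : Hom X Y := Quotient.mk _ s

noncomputable section

instance : Category.{max u v} (SpanS S) where
  Hom := Hom
  id X := Hom.mk (Sp.graph (𝟙 X.as))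
  comp := Quotient.map₂ Sp.comp fun _ _ h _ _ h' => ⟨h.1.comp h'.1, h.2.comp h'.2⟩
  id_comp := by
    rintro X Y ⟨s⟩
    exact Quotient.sound ⟨Sp.le_of_mem (by simp), Sp.le_of_mem (by simp)⟩
  comp_id := by
    rintro X Y ⟨s⟩
    exact Quotient.sound ⟨Sp.le_of_mem (by simp), Sp.le_of_mem (by simp)⟩
  assoc := by
    rintro X Y Z W ⟨s⟩ ⟨t⟩ ⟨w⟩
    refine Quotient.sound ⟨Sp.le_of_mem ?_, Sp.le_of_mem ?_⟩
    · intro U x y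
      simp only [Sp.mem_comp]
      rintro ⟨z, ⟨z', h, h'⟩, h''⟩
      exact ⟨z', h, z, h', h''⟩
    · intro U x y
      simp only [Sp.mem_comp]
      rintro ⟨z', h, z, h', h''⟩
      exact ⟨z, ⟨z', h, h'⟩, h''⟩

/-- The morphism of `Span^S(C)` given by a span. -/
def mk {X Y : SpanS S} (s : Sp X.as Y.as) : X ⟶ Y := Hom.mk s

lemma mk_surjective {X Y : SpanS S} (f : X ⟶ Y) : ∃ s, mk s = f := Quotient.exists_rep f

instance (X Y : SpanS S) : PartialOrder (X ⟶ Y) where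
  le := Quotient.lift₂ (Sp.Le S) fun _ _ _ _ h h' =>
    propext ⟨fun k => h.2.trans (k.trans h'.1), fun k => h.1.trans (k.trans h'.2)⟩
  le_refl := by rintro ⟨s⟩; exact Sp.le_refl s
  le_trans := by rintro ⟨s⟩ ⟨t⟩ ⟨w⟩ h h'; exact Sp.Le.trans (S := S) h h'
  le_antisymm := by rintro ⟨s⟩ ⟨t⟩ h h'; exact Quotient.sound ⟨h, h'⟩

lemma mk_le_mk {X Y : SpanS S} {s t : Sp X.as Y.as} : mk s ≤ mk t ↔ Sp.Le S s t := Iff.rfl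

lemma mk_comp_mk {X Y Z : SpanS S} (s : Sp X.as Y.as) (t : Sp Y.as Z.as) :
    mk s ≫ mk t = (mk (s.comp t) : X ⟶ Z) := rfl

lemma id_def (X : SpanS S) : 𝟙 X = mk (Sp.graph (𝟙 X.as)) := rfl

lemma mk_le {X Y : SpanS S} {s t : Sp X.as Y.as}
    (h : ∀ {U : C} (x : U ⟶ X.as) (y : U ⟶ Y.as), s.Mem x y → t.Mem x y) : mk s ≤ mk t :=
  Sp.le_of_mem h

lemma mk_eq {X Y : SpanS S} {s t : Sp X.as Y.as}
    (h : ∀ {U : C} (x : U ⟶ X.as) (y : U ⟶ Y.as), s.Mem x y ↔ t.Mem x y) : mk s = mk t :=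
  le_antisymm (mk_le fun x y => (h x y).1) (mk_le fun x y => (h x y).2)

/-- An isomorphism of `C`, as an isomorphism of `Span^S(C)` (by graphs). -/
@[simps] def graphIso {X Y : SpanS S} (e : X.as ≅ Y.as) : X ≅ Y where
  hom := mk (Sp.graph e.hom)
  inv := mk (Sp.graph e.inv)
  hom_inv_id := mk_eq fun x y => by simp [eq_comm]
  inv_hom_id := mk_eq fun x y => by simp [eq_comm]

lemma exists_comp_iso {X Y U : C} (e : X ≅ Y) (P : (U ⟶ X) → Prop) (z : U ⟶ Y) :
    (∃ y, P y ∧ y ≫ e.hom = z) ↔ P (z ≫ e.inv) := by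
  constructor
  · rintro ⟨y, h, rfl⟩; simpa using h
  · exact fun h => ⟨_, h, by simp⟩

/-- The product of two morphisms of `Span^S(C)`. -/
def tensorHom {X Y Z W : SpanS S} (f : X ⟶ Y) (g : Z ⟶ W) :
    (of (X.as ⊗ Z.as) : SpanS S) ⟶ of (Y.as ⊗ W.as) :=
  Quotient.map₂ (sa := Sp.setoid S X.as Y.as) (sb := Sp.setoid S Z.as W.as)
    (sc := Sp.setoid S (X.as ⊗ Z.as) (Y.as ⊗ W.as)) Sp.tensor
    (fun _ _ h _ _ h' => ⟨h.1.tensor h'.1, h.2.tensor h'.2⟩) f g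

instance : MonoidalCategoryStruct (SpanS S) where
  tensorObj X Y := of (X.as ⊗ Y.as)
  tensorUnit := of (𝟙_ C)
  tensorHom f g := tensorHom f g
  whiskerLeft X _ _ f := tensorHom (𝟙 X) f
  whiskerRight f Y := tensorHom f (𝟙 Y)
  associator X Y Z := graphIso (α_ X.as Y.as Z.as)
  leftUnitor X := graphIso (λ_ X.as)
  rightUnitor X := graphIso (ρ_ X.as)

lemma mk_tensor_mk {X Y Z W : SpanS S} (s : Sp X.as Y.as) (t : Sp Z.as W.as) :
    (mk s ⊗ₘ mk t) = (mk (s.tensor t) : X ⊗ Z ⟶ Y ⊗ W) := rfl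

lemma whiskerLeft_def (X : SpanS S) {Y Z : SpanS S} (f : Y ⟶ Z) : X ◁ f = 𝟙 X ⊗ₘ f := rfl

lemma whiskerRight_def {Y Z : SpanS S} (f : Y ⟶ Z) (X : SpanS S) : f ▷ X = f ⊗ₘ 𝟙 X := rfl

@[simp] lemma as_tensor (X Y : SpanS S) : (X ⊗ Y).as = X.as ⊗ Y.as := rfl
@[simp] lemma as_unit : (𝟙_ (SpanS S)).as = 𝟙_ C := rfl
lemma associator_def (X Y Z : SpanS S) : α_ X Y Z = graphIso (α_ X.as Y.as Z.as) := rfl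
lemma leftUnitor_def (X : SpanS S) : λ_ X = graphIso (λ_ X.as) := rfl
lemma rightUnitor_def (X : SpanS S) : ρ_ X = graphIso (ρ_ X.as) := rfl

lemma ext_iff_tensor {X Y U : C} (f g : U ⟶ X ⊗ Y) :
    f = g ↔ f ≫ fst _ _ = g ≫ fst _ _ ∧ f ≫ snd _ _ = g ≫ snd _ _ :=
  ⟨by rintro rfl; simp, fun h => CartesianMonoidalCategory.hom_ext _ _ h.1 h.2⟩

lemma eq_toUnit_iff {U : C} (f g : U ⟶ 𝟙_ C) : f = g ↔ True := by
  simp [toUnit_unique f g]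

/-- `R` is the class of the graph of `f` (auxiliary, used only to verify laws). -/
def IsGr {X Y : SpanS S} (R : X ⟶ Y) (f : X.as ⟶ Y.as) : Prop := R = mk (Sp.graph f)

namespace IsGr

lemma mk {X Y : SpanS S} (f : X.as ⟶ Y.as) : IsGr (SpanS.mk (Sp.graph f) : X ⟶ Y) f := rfl

lemma id (X : SpanS S) : IsGr (𝟙 X) (𝟙 X.as) := rfl

lemma iso {X Y : SpanS S} (e : X.as ≅ Y.as) : IsGr (graphIso e : X ≅ Y).hom e.hom := rfl

lemma isoInv {X Y : SpanS S} (e : X.as ≅ Y.as) : IsGr (graphIso e : X ≅ Y).inv e.inv := rfl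

lemma comp {X Y Z : SpanS S} {R : X ⟶ Y} {T : Y ⟶ Z} {f : X.as ⟶ Y.as} {g : Y.as ⟶ Z.as}
    (h : IsGr R f) (h' : IsGr T g) : IsGr (R ≫ T) (f ≫ g) := by
  obtain rfl := h
  obtain rfl := h'
  exact mk_eq fun x y => by simp

lemma tensor {X Y Z W : SpanS S} {R : X ⟶ Y} {T : Z ⟶ W} {f : X.as ⟶ Y.as} {g : Z.as ⟶ W.as}
    (h : IsGr R f) (h' : IsGr T g) : IsGr (R ⊗ₘ T) (f ⊗ₘ g) := by
  obtain rfl := h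
  obtain rfl := h'
  exact mk_eq fun x y => by simp [ext_iff_tensor]

lemma left (X : SpanS S) {Y Z : SpanS S} {R : Y ⟶ Z} {f : Y.as ⟶ Z.as} (h : IsGr R f) :
    IsGr (𝟙 X ⊗ₘ R) (X.as ◁ f) := by
  simpa using (id X).tensor h

lemma right (X : SpanS S) {Y Z : SpanS S} {R : Y ⟶ Z} {f : Y.as ⟶ Z.as} (h : IsGr R f) :
    IsGr (R ⊗ₘ 𝟙 X) (f ▷ X.as) := by
  simpa using h.tensor (id X)

lemma ext {X Y : SpanS S} {R T : X ⟶ Y} {f g : X.as ⟶ Y.as} (h : IsGr R f) (h' : IsGr T g)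
    (e : f = g) : R = T := by
  obtain rfl := h
  obtain rfl := h'
  rw [e]

end IsGr

instance : MonoidalCategory (SpanS S) := MonoidalCategory.ofTensorHom
  (id_tensorHom_id := fun X Y =>
    ((IsGr.id Y).left X).ext (IsGr.id _) (whiskerLeft_id _ _))
  (id_tensorHom := fun _ _ _ _ => rfl)
  (tensorHom_id := fun _ _ => rfl)
  (tensorHom_comp_tensorHom := by
    rintro X₁ Y₁ Z₁ X₂ Y₂ Z₂ ⟨f₁⟩ ⟨f₂⟩ ⟨g₁⟩ ⟨g₂⟩
    refine mk_eq fun x y => ?_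
    simp only [Sp.mem_comp, Sp.mem_tensor]
    constructor
    · rintro ⟨z, ⟨h₁, h₂⟩, h₃, h₄⟩
      exact ⟨⟨_, h₁, h₃⟩, ⟨_, h₂, h₄⟩⟩
    · rintro ⟨⟨z, h₁, h₃⟩, ⟨w, h₂, h₄⟩⟩
      exact ⟨lift z w, by simpa using ⟨h₁, h₂⟩, by simpa using ⟨h₃, h₄⟩⟩)
  (associator_naturality := by
    rintro X₁ X₂ X₃ Y₁ Y₂ Y₃ ⟨f₁⟩ ⟨f₂⟩ ⟨f₃⟩
    refine mk_eq fun x y => ?_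
    simp only [Sp.mem_comp, Sp.mem_graph, exists_comp_iso]
    simp [and_assoc])
  (leftUnitor_naturality := by
    rintro X Y ⟨f⟩
    refine mk_eq fun x y => ?_
    simp only [Sp.mem_comp, Sp.mem_graph, exists_comp_iso]
    simp [eq_toUnit_iff, leftUnitor_hom])
  (rightUnitor_naturality := by
    rintro X Y ⟨f⟩
    refine mk_eq fun x y => ?_
    simp only [Sp.mem_comp, Sp.mem_graph, exists_comp_iso]
    simp [eq_toUnit_iff, rightUnitor_hom])
  (pentagon := fun W X Y Z =>
    (((IsGr.iso _).right _).comp ((IsGr.iso _).comp ((IsGr.iso _).left _))).ext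
      ((IsGr.iso _).comp (IsGr.iso _)) (MonoidalCategory.pentagon _ _ _ _))
  (triangle := fun X Y =>
    ((IsGr.iso _).comp ((IsGr.iso _).left _)).ext ((IsGr.iso _).right _)
      (MonoidalCategory.triangle _ _))

variable [BraidedCategory C]

instance : SymmetricCategory (SpanS S) where
  braiding X Y := graphIso (β_ X.as Y.as)
  braiding_naturality_right := by
    rintro X Y Z ⟨f⟩
    refine mk_eq fun x y => ?_
    simp only [Sp.mem_comp, Sp.mem_graph, exists_comp_iso]
    simp [and_comm]
  braiding_naturality_left := by
    rintro X Y ⟨f⟩ Z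
    refine mk_eq fun x y => ?_
    simp only [Sp.mem_comp, Sp.mem_graph, exists_comp_iso]
    simp [and_comm]
  hexagon_forward X Y Z :=
    ((IsGr.iso _).comp ((IsGr.iso _).comp (IsGr.iso _))).ext
      (((IsGr.iso _).right _).comp ((IsGr.iso _).comp ((IsGr.iso _).left _)))
      (BraidedCategory.hexagon_forward X.as Y.as Z.as)
  hexagon_reverse X Y Z :=
    ((IsGr.isoInv _).comp ((IsGr.iso _).comp (IsGr.isoInv _))).ext
      (((IsGr.iso _).left _).comp ((IsGr.isoInv _).comp ((IsGr.iso _).right _)))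
      (BraidedCategory.hexagon_reverse X.as Y.as Z.as)
  symmetry X Y :=
    ((IsGr.iso _).comp (IsGr.iso _)).ext (IsGr.id _) (SymmetricCategory.symmetry X.as Y.as)

lemma IsGr.tensorμ (X Y Z W : SpanS S) : IsGr (tensorμ X Y Z W) (tensorμ X.as Y.as Z.as W.as) := by
  have h₁ : IsGr ((β_ Y Z).hom ▷ W) ((β_ Y.as Z.as).hom ▷ W.as) := (IsGr.iso _).right W
  simp only [MonoidalCategory.tensorμ]
  exact (IsGr.iso _).comp (((IsGr.isoInv _).left X).comp ((h₁.left X).comp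
    (((IsGr.iso _).left X).comp (IsGr.isoInv _))))

instance (X : SpanS S) : ComonObj X where
  counit := mk (Sp.graph (toUnit X.as))
  comul := mk (Sp.graph (lift (𝟙 X.as) (𝟙 X.as)))
  counit_comul :=
    ((IsGr.mk _).comp ((IsGr.mk _).right _)).ext (IsGr.isoInv _) (by
      simp [ext_iff_tensor])
  comul_counit :=
    ((IsGr.mk _).comp ((IsGr.mk _).left _)).ext (IsGr.isoInv _) (by
      simp [ext_iff_tensor])
  comul_assoc :=
    ((IsGr.mk _).comp ((IsGr.mk _).left _)).ext
      ((IsGr.mk _).comp (((IsGr.mk _).right _).comp (IsGr.iso _))) (by simp)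

instance (X : SpanS S) : IsCommComonObj X where
  comul_comm := ((IsGr.mk _).comp (IsGr.iso _)).ext (IsGr.mk _) (by simp)

instance : CartesianBicategory (SpanS S) where
  copy_tensor X Y :=
    (IsGr.mk _).ext (((IsGr.mk _).tensor (IsGr.mk _)).comp (IsGr.tensorμ X X Y Y)) (by
      change lift (𝟙 (X.as ⊗ Y.as)) (𝟙 (X.as ⊗ Y.as)) =
        (lift (𝟙 X.as) (𝟙 X.as) ⊗ₘ lift (𝟙 Y.as) (𝟙 Y.as)) ≫ tensorμ X.as X.as Y.as Y.as
      simp [ext_iff_tensor])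
  discard_tensor X Y :=
    (IsGr.mk _).ext (((IsGr.mk _).tensor (IsGr.mk _)).comp (IsGr.iso _)) (toUnit_unique _ _)
  copy_unit := (IsGr.mk _).ext (IsGr.isoInv _) (by
      change lift (𝟙 (𝟙_ C)) (𝟙 (𝟙_ C)) = _
      simp [ext_iff_tensor])
  discard_unit := (IsGr.mk _).ext (IsGr.id _) (toUnit_unique _ _)
  homOrder := inferInstance
  comp_mono := by
    rintro X Y Z ⟨f⟩ ⟨f'⟩ ⟨g⟩ ⟨g'⟩ h h'
    exact Sp.Le.comp (S := S) h h'
  tensor_mono := by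
    rintro X Y Z W ⟨f⟩ ⟨f'⟩ ⟨g⟩ ⟨g'⟩ h h'
    exact Sp.Le.tensor (S := S) h h'
  cocopy X := mk (Sp.cograph (lift (𝟙 X.as) (𝟙 X.as)))
  codiscard X := mk (Sp.cograph (toUnit X.as))
  copy_unit_le X := mk_le fun x y => by
    simp +contextual
  copy_counit_le X := mk_le fun x y => by
    rw [Sp.mem_comp]
    rintro ⟨z, h, h'⟩
    simp_all
  discard_unit_le X := mk_le fun x y => by
    simp
  discard_counit_le X := mk_le fun x y _ => by
    rw [Sp.mem_graph]
    exact toUnit_unique _ _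
  frobenius_left X := by
    refine mk_eq fun {U} (x : U ⟶ X.as ⊗ X.as) (y : U ⟶ X.as ⊗ X.as) => ?_
    simp only [Sp.mem_comp]
    constructor
    · rintro ⟨w, hw, w', hw', h⟩
      simp_all [ext_iff_tensor]
    · rintro ⟨w, hw, w'⟩
      simp_all [ext_iff_tensor]
      exact ⟨lift (lift (y ≫ snd X.as X.as) (y ≫ snd X.as X.as)) (y ≫ snd X.as X.as), by simp,
        lift (y ≫ snd X.as X.as) (lift (y ≫ snd X.as X.as) (y ≫ snd X.as X.as)), by simp⟩
  frobenius_right X := by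
    refine mk_eq fun {U} (x : U ⟶ X.as ⊗ X.as) (y : U ⟶ X.as ⊗ X.as) => ?_
    simp only [Sp.mem_comp]
    constructor
    · rintro ⟨w, hw, w', hw', h⟩
      simp_all [ext_iff_tensor]
    · rintro ⟨w, hw, w'⟩
      simp_all [ext_iff_tensor]
      exact ⟨lift (y ≫ snd X.as X.as) (lift (y ≫ snd X.as X.as) (y ≫ snd X.as X.as)), by simp,
        lift (lift (y ≫ snd X.as X.as) (y ≫ snd X.as X.as)) (y ≫ snd X.as X.as), by simp⟩
  lax_copy := by
    rintro X Y ⟨f⟩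
    refine mk_le fun {U} x (y : U ⟶ Y.as ⊗ Y.as) => ?_
    rw [Sp.mem_comp, Sp.mem_comp]
    rintro ⟨z, h, h'⟩
    rw [Sp.mem_graph] at h'
    subst h'
    exact ⟨lift x x, by simp, by simpa using h⟩
  lax_discard := by
    rintro X Y ⟨f⟩
    refine mk_le fun x y _ => ?_
    rw [Sp.mem_graph]
    exact toUnit_unique _ _

end

end SpanS

/-! ### Regular epimorphisms form a system of covers -/

section RegularEpi

variable {C : Type u} [Category.{v} C]

lemma strongEpi_of_isRegularEpi {X Y : C} (f : X ⟶ Y) (h : IsRegularEpi f) : StrongEpi f :=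
  inferInstance

variable [Regular C]

lemma regularEpi_iff_strongEpi {X Y : C} (f : X ⟶ Y) :
    MorphismProperty.regularEpi C f ↔ StrongEpi f :=
  ⟨strongEpi_of_isRegularEpi f, fun _ => Regular.isRegularEpi_of_extremalEpi f⟩

lemma regularEpi_of_comp {X Y Z : C} (f : X ⟶ Y) (π : Y ⟶ Z)
    (h : MorphismProperty.regularEpi C (f ≫ π)) : MorphismProperty.regularEpi C π := by
  rw [regularEpi_iff_strongEpi] at h ⊢
  exact strongEpi_of_strongEpi f π

lemma regularEpi_comp {X Y Z : C} (f : X ⟶ Y) (g : Y ⟶ Z)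
    (h : MorphismProperty.regularEpi C f) (h' : MorphismProperty.regularEpi C g) :
    MorphismProperty.regularEpi C (f ≫ g) := by
  rw [regularEpi_iff_strongEpi] at h h' ⊢
  exact strongEpi_comp f g

variable [CartesianMonoidalCategory C]

lemma isPullback_tensor {X Y Z W : C} (f : X ⟶ Y) (g : Z ⟶ W) :
    IsPullback (fst X Z) (f ▷ Z) f (fst Y Z) ∧ IsPullback (snd Y Z) (Y ◁ g) g (snd Y W) := by
  refine ⟨⟨⟨by simp⟩, ⟨PullbackCone.IsLimit.mk _ (fun s => lift s.fst (s.snd ≫ snd _ _)) ?_ ?_ ?_⟩⟩,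
    ⟨⟨by simp⟩, ⟨PullbackCone.IsLimit.mk _ (fun s => lift (s.snd ≫ fst _ _) s.fst) ?_ ?_ ?_⟩⟩⟩
  · simp
  · intro s
    ext
    · simp [s.condition]
    · simp
  · intro s m h₁ h₂
    ext
    · simp [h₁]
    · simp [← h₂]
  · simp
  · intro s
    ext
    · simp
    · simp [s.condition]
  · intro s m h₁ h₂
    ext
    · simp [← h₂]
    · simp [h₁]

instance : IsSystemOfCovers (MorphismProperty.regularEpi C) where
  id_mem X := MorphismProperty.id_mem _ X
  comp_mem := regularEpi_comp
  prod_mem f g hf hg := by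
    rw [MonoidalCategory.tensorHom_def]
    have := Regular.regularEpiIsStableUnderBaseChange (C := C)
    exact regularEpi_comp _ _
      (MorphismProperty.of_isPullback (isPullback_tensor f g).1 hf)
      (MorphismProperty.of_isPullback (isPullback_tensor f g).2 hg)
  weakPullback_mem {X Y Z f π} c hc hπ := by
    have := Regular.regularEpiIsStableUnderBaseChange (C := C)
    have h : MorphismProperty.regularEpi C (pullback.fst f π) :=
      MorphismProperty.of_isPullback (IsPullback.of_hasPullback f π).flip hπ
    rw [← PullbackCone.IsWeakLimit.lift_fst hc _ _ pullback.condition] at h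
    exact regularEpi_of_comp _ _ h
  of_comp_mem := regularEpi_of_comp

end RegularEpi

/-! ### The cartesian bicategory `Rel(C)` of a regular category

Objects are those of `C`, morphisms are jointly monic spans (up to isomorphism), composition is the
image of the composite by pullback, the monoidal product is the product of `C`, and the (co)monoid
structures are given by the same spans as above. -/

section JointlyMono

variable {C : Type u} [Category.{v} C] [CartesianMonoidalCategory C]

/-- Jointly monic spans. -/
structure JMSpan (X Y : C) extends Span (⊤ : MorphismProperty C) (⊤ : MorphismProperty C) X Y where
  mono : Mono (lift l r)

namespace JMSpan

/-- The ordering of jointly monic spans: existence of a morphism of spans. -/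
def Le {X Y : C} (s t : JMSpan X Y) : Prop := Nonempty (s.toSpan ⟶ t.toSpan)

/-- Two jointly monic spans are identified if each is `≤` the other; as the spans are jointly
monic, this says exactly that they are isomorphic. -/
def setoid (X Y : C) : Setoid (JMSpan X Y) where
  r s t := Le s t ∧ Le t s
  iseqv := ⟨fun _ => ⟨⟨𝟙 _⟩, ⟨𝟙 _⟩⟩, fun h => ⟨h.2, h.1⟩,
    fun ⟨⟨a⟩, ⟨b⟩⟩ ⟨⟨c⟩, ⟨d⟩⟩ => ⟨⟨a ≫ c⟩, ⟨d ≫ b⟩⟩⟩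

lemma mono_lift_iff {X Y A : C} (l : A ⟶ X) (r : A ⟶ Y) : Mono (lift l r) ↔
    ∀ {U : C} (a b : U ⟶ A), a ≫ l = b ≫ l → a ≫ r = b ≫ r → a = b := by
  constructor
  · intro h U a b h₁ h₂
    rw [← cancel_mono (lift l r)]
    simp [h₁, h₂]
  · refine fun h => ⟨fun a b hab => h a b ?_ ?_⟩
    · simpa using hab =≫ fst _ _
    · simpa using hab =≫ snd _ _

/-- The graph of a morphism. -/
def graph {X Y : C} (f : X ⟶ Y) : JMSpan X Y :=
  ⟨Sp.graph f, (mono_lift_iff _ _).2 fun _ _ h _ => by simpa using h⟩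

/-- The opposite of the graph of a morphism. -/
def cograph {X Y : C} (f : X ⟶ Y) : JMSpan Y X :=
  ⟨Sp.cograph f, (mono_lift_iff _ _).2 fun _ _ _ h => by simpa using h⟩

/-- The product of two jointly monic spans. -/
def tensor {X Y Z W : C} (s : JMSpan X Y) (t : JMSpan Z W) : JMSpan (X ⊗ Z) (Y ⊗ W) :=
  ⟨Sp.tensor s.toSpan t.toSpan, (mono_lift_iff _ _).2 fun a b h₁ h₂ => by
    apply CartesianMonoidalCategory.hom_ext
    · exact (mono_lift_iff _ _).1 s.mono _ _ (by simpa using h₁ =≫ fst _ _) (by simpa using h₂ =≫ fst _ _)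
    · exact (mono_lift_iff _ _).1 t.mono _ _ (by simpa using h₁ =≫ snd _ _) (by simpa using h₂ =≫ snd _ _)⟩

variable [Regular C]

/-- The composite of two spans, computed by a pullback. -/
noncomputable def pullbackComp {X Y Z : C} (s : Sp X Y) (t : Sp Y Z) : Sp X Z :=
  Sp.mk (pullback.fst s.r t.l ≫ s.l) (pullback.snd s.r t.l ≫ t.r)

/-- The image of a span `X ⟵ A ⟶ Y`: the jointly monic span given by the monomorphism in the
(regular epi, mono)-factorisation of `A ⟶ X ⊗ Y`. -/
noncomputable def image {X Y : C} (s : Sp X Y) : JMSpan X Y :=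
  ⟨Sp.mk ((Regular.strongEpiMonoFactorisation (lift s.l s.r)).m ≫ fst X Y)
      ((Regular.strongEpiMonoFactorisation (lift s.l s.r)).m ≫ snd X Y), by
    rw [← comp_lift, lift_fst_snd, Category.comp_id]
    infer_instance⟩

/-- The composite of two jointly monic spans: the image of their composite as spans. -/
noncomputable def comp {X Y Z : C} (s : JMSpan X Y) (t : JMSpan Y Z) : JMSpan X Z :=
  image (pullbackComp s.toSpan t.toSpan)

lemma le_iff {X Y : C} (s t : JMSpan X Y) :
    Le s t ↔ Sp.Le (MorphismProperty.regularEpi C) s.toSpan t.toSpan := by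
  constructor
  · rintro ⟨a⟩
    exact ⟨_, 𝟙 _, a.hom, MorphismProperty.id_mem _ _, by simp, by simp⟩
  · rintro ⟨A, π, α, hπ, h₁, h₂⟩
    have := strongEpi_of_isRegularEpi π hπ
    have := t.mono
    have sq : CommSq α π (lift t.l t.r) (lift s.l s.r) := ⟨by simp [h₁, h₂]⟩
    exact ⟨⟨sq.lift, by simpa using sq.fac_right =≫ fst _ _, by simpa using sq.fac_right =≫ snd _ _⟩⟩

lemma image_le {X Y : C} (s : Sp X Y) :
    Sp.Le (MorphismProperty.regularEpi C) (image s).toSpan s :=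
  ⟨s.apex, (Regular.strongEpiMonoFactorisation (lift s.l s.r)).e, 𝟙 _,
    Regular.instIsRegularEpiEStrongEpiMonoFactorisation _, by simp [image], by simp [image]⟩

lemma le_image {X Y : C} (s : Sp X Y) :
    Sp.Le (MorphismProperty.regularEpi C) s (image s).toSpan :=
  ⟨s.apex, 𝟙 _, (Regular.strongEpiMonoFactorisation (lift s.l s.r)).e,
    MorphismProperty.id_mem _ _, by simp [image], by simp [image]⟩

lemma mem_pullbackComp {X Y Z U : C} (s : Sp X Y) (t : Sp Y Z) (x : U ⟶ X) (z : U ⟶ Z) :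
    (pullbackComp s t).Mem x z ↔ (s.comp t).Mem x z := by
  rw [Sp.mem_comp]
  constructor
  · rintro ⟨(a : U ⟶ pullback s.r t.l), rfl, rfl⟩
    exact ⟨a ≫ pullback.fst s.r t.l ≫ s.r, ⟨a ≫ pullback.fst s.r t.l, by simp [pullbackComp]⟩,
      ⟨a ≫ pullback.snd s.r t.l, by simp [pullbackComp, pullback.condition]⟩⟩
  · rintro ⟨y, ⟨a, rfl, rfl⟩, b, h, rfl⟩
    exact ⟨pullback.lift a b h.symm, pullback.lift_fst_assoc _ _ _ _,
      pullback.lift_snd_assoc _ _ _ _⟩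

lemma mk_comp {X Y Z : SpanS (MorphismProperty.regularEpi C)} (s : JMSpan X.as Y.as)
    (t : JMSpan Y.as Z.as) :
    (SpanS.mk (s.comp t).toSpan : X ⟶ Z) = (SpanS.mk s.toSpan : X ⟶ Y) ≫ SpanS.mk t.toSpan :=
  (le_antisymm (SpanS.mk_le_mk.2 (image_le _)) (SpanS.mk_le_mk.2 (le_image _))).trans
    (SpanS.mk_eq (mem_pullbackComp s.toSpan t.toSpan))

lemma Le.refl {X Y : C} (s : JMSpan X Y) : Le s s := ⟨𝟙 _⟩

lemma Le.trans {X Y : C} {s t w : JMSpan X Y} : Le s t → Le t w → Le s w :=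
  fun ⟨a⟩ ⟨b⟩ => ⟨a ≫ b⟩

lemma Le.comp {X Y Z : C} {s s' : JMSpan X Y} {t t' : JMSpan Y Z} (h : Le s s') (h' : Le t t') :
    Le (s.comp t) (s'.comp t') := by
  rw [le_iff] at h h' ⊢
  refine (image_le _).trans (Sp.Le.trans ?_ (le_image _))
  refine (Sp.le_of_mem fun x y => (mem_pullbackComp _ _ x y).1).trans ((h.comp h').trans
    (Sp.le_of_mem fun x y => (mem_pullbackComp _ _ x y).2))

lemma Le.tensor {X Y Z W : C} {s s' : JMSpan X Y} {t t' : JMSpan Z W} (h : Le s s')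
    (h' : Le t t') : Le (s.tensor t) (s'.tensor t') := by
  rw [le_iff] at h h' ⊢
  exact Sp.Le.tensor h h'

lemma comp_congr {X Y Z : C} (s s' : JMSpan X Y) (h : (setoid X Y) s s') (t t' : JMSpan Y Z)
    (h' : (setoid Y Z) t t') : (setoid X Z) (s.comp t) (s'.comp t') :=
  ⟨h.1.comp h'.1, h.2.comp h'.2⟩

lemma tensor_congr {X Y Z W : C} (s s' : JMSpan X Y) (h : (setoid X Y) s s') (t t' : JMSpan Z W)
    (h' : (setoid Z W) t t') : (setoid (X ⊗ Z) (Y ⊗ W)) (s.tensor t) (s'.tensor t') :=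
  ⟨h.1.tensor h'.1, h.2.tensor h'.2⟩

end JMSpan

variable (C) in
/-- The objects of `Rel(C)`: those of `C`. -/
structure Relations where of ::
  as : C

end JointlyMono

namespace Relations

variable {C : Type u} [Category.{v} C] [CartesianMonoidalCategory C] [Regular C]

/-- Morphisms of `Rel(C)`: jointly monic spans, up to isomorphism. -/
def Hom (X Y : Relations C) : Type (max u v) := Quotient (JMSpan.setoid X.as Y.as)

noncomputable section

instance : CategoryStruct.{max u v} (Relations C) where
  Hom := Hom
  id X := Quotient.mk _ (JMSpan.graph (𝟙 X.as))
  comp {X Y Z} := Quotient.map₂ (sa := JMSpan.setoid X.as Y.as) (sb := JMSpan.setoid Y.as Z.as)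
    (sc := JMSpan.setoid X.as Z.as) JMSpan.comp JMSpan.comp_congr

/-- The morphism of `Rel(C)` given by a jointly monic span. -/
def mk {X Y : Relations C} (s : JMSpan X.as Y.as) : X ⟶ Y := Quotient.mk _ s

instance (X Y : Relations C) : LE (X ⟶ Y) where
  le := Quotient.lift₂ JMSpan.Le fun _ _ _ _ h h' =>
    propext ⟨fun k => (h.2.trans k).trans h'.1, fun k => (h.1.trans k).trans h'.2⟩

/-- The product of two morphisms of `Rel(C)`. -/
def tensorHom {X Y Z W : Relations C} (f : X ⟶ Y) (g : Z ⟶ W) :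
    (of (X.as ⊗ Z.as) : Relations C) ⟶ of (Y.as ⊗ W.as) :=
  Quotient.map₂ (sa := JMSpan.setoid X.as Y.as) (sb := JMSpan.setoid Z.as W.as)
    (sc := JMSpan.setoid (X.as ⊗ Z.as) (Y.as ⊗ W.as)) JMSpan.tensor JMSpan.tensor_congr f g

/-- An object of `Rel(C)`, regarded as an object of `Span^S(C)` for `S` the class of regular
epimorphisms (auxiliary, used only to verify laws). -/
def toS (X : Relations C) : SpanS (MorphismProperty.regularEpi C) := SpanS.of X.as

/-- `R` and `T` are represented by a common span (auxiliary, used only to verify laws). -/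
def Im {X Y : Relations C} (R : X ⟶ Y) (T : toS X ⟶ toS Y) : Prop :=
  ∃ s : JMSpan X.as Y.as, R = mk s ∧ T = SpanS.mk s.toSpan

namespace Im

lemma exists_left {X Y : Relations C} (R : X ⟶ Y) : ∃ T, Im R T := by
  obtain ⟨s⟩ := R
  exact ⟨_, s, rfl, rfl⟩

lemma mk {X Y : Relations C} (s : JMSpan X.as Y.as) :
    Im (Relations.mk s : X ⟶ Y) (SpanS.mk s.toSpan) := ⟨s, rfl, rfl⟩

lemma id (X : Relations C) : Im (𝟙 X) (𝟙 (toS X)) := ⟨JMSpan.graph (𝟙 X.as), rfl, rfl⟩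

lemma comp {X Y Z : Relations C} {R : X ⟶ Y} {R' : Y ⟶ Z} {T : toS X ⟶ toS Y}
    {T' : toS Y ⟶ toS Z} (h : Im R T) (h' : Im R' T') : Im (R ≫ R') (T ≫ T') := by
  obtain ⟨s, rfl, rfl⟩ := h
  obtain ⟨t, rfl, rfl⟩ := h'
  exact ⟨s.comp t, rfl, (JMSpan.mk_comp (X := toS X) (Y := toS Y) (Z := toS Z) s t).symm⟩

lemma tensor {X Y Z W : Relations C} {R : X ⟶ Y} {R' : Z ⟶ W} {T : toS X ⟶ toS Y}
    {T' : toS Z ⟶ toS W} (h : Im R T) (h' : Im R' T') : Im (tensorHom R R') (T ⊗ₘ T') := by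
  obtain ⟨s, rfl, rfl⟩ := h
  obtain ⟨t, rfl, rfl⟩ := h'
  exact ⟨s.tensor t, rfl, rfl⟩

lemma le_iff {X Y : Relations C} {R R' : X ⟶ Y} {T T' : toS X ⟶ toS Y}
    (h : Im R T) (h' : Im R' T') : R ≤ R' ↔ T ≤ T' := by
  obtain ⟨s, rfl, rfl⟩ := h
  obtain ⟨t, rfl, rfl⟩ := h'
  exact JMSpan.le_iff s t

lemma ext {X Y : Relations C} {R R' : X ⟶ Y} {T T' : toS X ⟶ toS Y}
    (h : Im R T) (h' : Im R' T') (e : T = T') : R = R' := by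
  have h₁ := (le_iff h h').2 e.le
  have h₂ := (le_iff h' h).2 e.ge
  obtain ⟨s, rfl, rfl⟩ := h
  obtain ⟨t, rfl, rfl⟩ := h'
  exact Quotient.sound ⟨h₁, h₂⟩

end Im

instance : Category.{max u v} (Relations C) where
  id_comp f := by
    obtain ⟨T, h⟩ := Im.exists_left f
    exact ((Im.id _).comp h).ext h (Category.id_comp T)
  comp_id f := by
    obtain ⟨T, h⟩ := Im.exists_left f
    exact (h.comp (Im.id _)).ext h (Category.comp_id T)
  assoc f g k := by
    obtain ⟨F, hf⟩ := Im.exists_left f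
    obtain ⟨G, hg⟩ := Im.exists_left g
    obtain ⟨K, hk⟩ := Im.exists_left k
    exact ((hf.comp hg).comp hk).ext (hf.comp (hg.comp hk)) (Category.assoc F G K)

instance (X Y : Relations C) : PartialOrder (X ⟶ Y) where
  le_refl := by rintro ⟨s⟩; exact JMSpan.Le.refl s
  le_trans := by rintro ⟨s⟩ ⟨t⟩ ⟨w⟩ h h'; exact JMSpan.Le.trans h h'
  le_antisymm := by rintro ⟨s⟩ ⟨t⟩ h h'; exact Quotient.sound ⟨h, h'⟩

/-- An isomorphism of `C`, as an isomorphism of `Rel(C)` (by graphs). -/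
@[simps] def graphIso {X Y : Relations C} (e : X.as ≅ Y.as) : X ≅ Y where
  hom := mk (JMSpan.graph e.hom)
  inv := mk (JMSpan.graph e.inv)
  hom_inv_id := ((Im.mk _).comp (Im.mk _)).ext (Im.id _)
    (SpanS.graphIso (X := toS X) (Y := toS Y) e).hom_inv_id
  inv_hom_id := ((Im.mk _).comp (Im.mk _)).ext (Im.id _)
    (SpanS.graphIso (X := toS X) (Y := toS Y) e).inv_hom_id

lemma Im.iso {X Y : Relations C} (e : X.as ≅ Y.as) :
    Im (graphIso e : X ≅ Y).hom (SpanS.graphIso (X := toS X) (Y := toS Y) e).hom :=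
  Im.mk _

lemma Im.isoInv {X Y : Relations C} (e : X.as ≅ Y.as) :
    Im (graphIso e : X ≅ Y).inv (SpanS.graphIso (X := toS X) (Y := toS Y) e).inv :=
  Im.mk _

instance : MonoidalCategoryStruct (Relations C) where
  tensorObj X Y := of (X.as ⊗ Y.as)
  tensorUnit := of (𝟙_ C)
  tensorHom f g := tensorHom f g
  whiskerLeft X _ _ f := tensorHom (𝟙 X) f
  whiskerRight f Y := tensorHom f (𝟙 Y)
  associator X Y Z := graphIso (α_ X.as Y.as Z.as)
  leftUnitor X := graphIso (λ_ X.as)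
  rightUnitor X := graphIso (ρ_ X.as)

instance : MonoidalCategory (Relations C) := MonoidalCategory.ofTensorHom
  (id_tensorHom_id := fun X Y =>
    ((Im.id X).tensor (Im.id Y)).ext (Im.id _) (id_tensorHom_id (toS X) (toS Y)))
  (id_tensorHom := fun _ _ _ _ => rfl)
  (tensorHom_id := fun _ _ => rfl)
  (tensorHom_comp_tensorHom := fun f₁ f₂ g₁ g₂ => by
    obtain ⟨F₁, h₁⟩ := Im.exists_left f₁
    obtain ⟨F₂, h₂⟩ := Im.exists_left f₂
    obtain ⟨G₁, h₃⟩ := Im.exists_left g₁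
    obtain ⟨G₂, h₄⟩ := Im.exists_left g₂
    exact ((h₁.tensor h₂).comp (h₃.tensor h₄)).ext ((h₁.comp h₃).tensor (h₂.comp h₄))
      (MonoidalCategory.tensorHom_comp_tensorHom F₁ F₂ G₁ G₂))
  (associator_naturality := fun f₁ f₂ f₃ => by
    obtain ⟨F₁, h₁⟩ := Im.exists_left f₁
    obtain ⟨F₂, h₂⟩ := Im.exists_left f₂
    obtain ⟨F₃, h₃⟩ := Im.exists_left f₃
    exact (((h₁.tensor h₂).tensor h₃).comp (Im.iso _)).ext
      ((Im.iso _).comp (h₁.tensor (h₂.tensor h₃)))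
      (MonoidalCategory.associator_naturality F₁ F₂ F₃))
  (leftUnitor_naturality := fun f => by
    obtain ⟨F, h⟩ := Im.exists_left f
    exact (((Im.id _).tensor h).comp (Im.iso _)).ext ((Im.iso _).comp h)
      (MonoidalCategory.leftUnitor_naturality F))
  (rightUnitor_naturality := fun f => by
    obtain ⟨F, h⟩ := Im.exists_left f
    exact ((h.tensor (Im.id _)).comp (Im.iso _)).ext ((Im.iso _).comp h)
      (MonoidalCategory.rightUnitor_naturality F))
  (pentagon := fun W X Y Z =>
    (((Im.iso _).tensor (Im.id _)).comp ((Im.iso _).comp ((Im.id _).tensor (Im.iso _)))).ext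
      ((Im.iso _).comp (Im.iso _)) (MonoidalCategory.pentagon (toS W) (toS X) (toS Y) (toS Z)))
  (triangle := fun X Y =>
    ((Im.iso _).comp ((Im.id _).tensor (Im.iso _))).ext ((Im.iso _).tensor (Im.id _))
      (MonoidalCategory.triangle (toS X) (toS Y)))

variable [BraidedCategory C]

instance : SymmetricCategory (Relations C) where
  braiding X Y := graphIso (β_ X.as Y.as)
  braiding_naturality_right X Y Z f := by
    obtain ⟨F, h⟩ := Im.exists_left f
    exact (((Im.id _).tensor h).comp (Im.iso _)).ext ((Im.iso _).comp (h.tensor (Im.id _)))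
      (BraidedCategory.braiding_naturality_right (toS X) F)
  braiding_naturality_left f Z := by
    obtain ⟨F, h⟩ := Im.exists_left f
    exact ((h.tensor (Im.id _)).comp (Im.iso _)).ext ((Im.iso _).comp ((Im.id _).tensor h))
      (BraidedCategory.braiding_naturality_left F (toS Z))
  hexagon_forward X Y Z :=
    ((Im.iso _).comp ((Im.iso _).comp (Im.iso _))).ext
      (((Im.iso _).tensor (Im.id _)).comp ((Im.iso _).comp ((Im.id _).tensor (Im.iso _))))
      (BraidedCategory.hexagon_forward (toS X) (toS Y) (toS Z))
  hexagon_reverse X Y Z :=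
    ((Im.isoInv _).comp ((Im.iso _).comp (Im.isoInv _))).ext
      (((Im.id _).tensor (Im.iso _)).comp ((Im.isoInv _).comp ((Im.iso _).tensor (Im.id _))))
      (BraidedCategory.hexagon_reverse (toS X) (toS Y) (toS Z))
  symmetry X Y :=
    ((Im.iso _).comp (Im.iso _)).ext (Im.id _) (SymmetricCategory.symmetry (toS X) (toS Y))

instance (X : Relations C) : ComonObj X where
  counit := mk (JMSpan.graph (toUnit X.as))
  comul := mk (JMSpan.graph (lift (𝟙 X.as) (𝟙 X.as)))
  counit_comul :=
    ((Im.mk _).comp ((Im.mk _).tensor (Im.id _))).ext (Im.isoInv _)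
      (ComonObj.counit_comul (X := toS X))
  comul_counit :=
    ((Im.mk _).comp ((Im.id _).tensor (Im.mk _))).ext (Im.isoInv _)
      (ComonObj.comul_counit (X := toS X))
  comul_assoc :=
    ((Im.mk _).comp ((Im.id _).tensor (Im.mk _))).ext
      ((Im.mk _).comp (((Im.mk _).tensor (Im.id _)).comp (Im.iso _)))
      (ComonObj.comul_assoc (X := toS X))

instance (X : Relations C) : IsCommComonObj X where
  comul_comm := ((Im.mk _).comp (Im.iso _)).ext (Im.mk _) (IsCommComonObj.comul_comm (toS X))

lemma Im.tensorμ (X Y Z W : Relations C) :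
    Im (tensorμ X Y Z W) (tensorμ (toS X) (toS Y) (toS Z) (toS W)) := by
  have h₁ : Im ((β_ Y Z).hom ▷ W) ((β_ (toS Y) (toS Z)).hom ▷ (toS W)) :=
    (Im.iso _).tensor (Im.id W)
  simp only [MonoidalCategory.tensorμ]
  exact (Im.iso _).comp (((Im.id X).tensor (Im.isoInv _)).comp (((Im.id X).tensor h₁).comp
    (((Im.id X).tensor (Im.iso _)).comp (Im.isoInv _))))

instance : CartesianBicategory (Relations C) where
  copy_tensor X Y :=
    (Im.mk _).ext (((Im.mk _).tensor (Im.mk _)).comp (Im.tensorμ X X Y Y))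
      (CopyDiscardCategory.copy_tensor (toS X) (toS Y))
  discard_tensor X Y :=
    (Im.mk _).ext (((Im.mk _).tensor (Im.mk _)).comp (Im.iso _))
      (CopyDiscardCategory.discard_tensor (toS X) (toS Y))
  copy_unit := (Im.mk _).ext (Im.isoInv _)
    (CopyDiscardCategory.copy_unit (C := SpanS (MorphismProperty.regularEpi C)))
  discard_unit := (Im.mk _).ext (Im.id _)
    (CopyDiscardCategory.discard_unit (C := SpanS (MorphismProperty.regularEpi C)))
  homOrder := inferInstance
  comp_mono {X Y Z R R' T T'} h h' := by
    obtain ⟨_, h₁⟩ := Im.exists_left R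
    obtain ⟨_, h₂⟩ := Im.exists_left R'
    obtain ⟨_, h₃⟩ := Im.exists_left T
    obtain ⟨_, h₄⟩ := Im.exists_left T'
    exact ((h₁.comp h₃).le_iff (h₂.comp h₄)).2
      (CartesianBicategory.comp_mono ((h₁.le_iff h₂).1 h) ((h₃.le_iff h₄).1 h'))
  tensor_mono {X Y Z W R R' T T'} h h' := by
    obtain ⟨_, h₁⟩ := Im.exists_left R
    obtain ⟨_, h₂⟩ := Im.exists_left R'
    obtain ⟨_, h₃⟩ := Im.exists_left T
    obtain ⟨_, h₄⟩ := Im.exists_left T'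
    exact ((h₁.tensor h₃).le_iff (h₂.tensor h₄)).2
      (CartesianBicategory.tensor_mono ((h₁.le_iff h₂).1 h) ((h₃.le_iff h₄).1 h'))
  cocopy X := mk (JMSpan.cograph (lift (𝟙 X.as) (𝟙 X.as)))
  codiscard X := mk (JMSpan.cograph (toUnit X.as))
  copy_unit_le X := ((Im.id _).le_iff ((Im.mk _).comp (Im.mk _))).2
    (CartesianBicategory.copy_unit_le (toS X))
  copy_counit_le X := (((Im.mk _).comp (Im.mk _)).le_iff (Im.id _)).2
    (CartesianBicategory.copy_counit_le (toS X))
  discard_unit_le X := ((Im.id _).le_iff ((Im.mk _).comp (Im.mk _))).2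
    (CartesianBicategory.discard_unit_le (toS X))
  discard_counit_le X := (((Im.mk _).comp (Im.mk _)).le_iff (Im.id _)).2
    (CartesianBicategory.discard_counit_le (toS X))
  frobenius_left X :=
    (((Im.mk _).tensor (Im.id _)).comp ((Im.iso _).comp ((Im.id _).tensor (Im.mk _)))).ext
      ((Im.mk _).comp (Im.mk _)) (CartesianBicategory.frobenius_left (toS X))
  frobenius_right X :=
    (((Im.id _).tensor (Im.mk _)).comp ((Im.isoInv _).comp ((Im.mk _).tensor (Im.id _)))).ext
      ((Im.mk _).comp (Im.mk _)) (CartesianBicategory.frobenius_right (toS X))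
  lax_copy R := by
    obtain ⟨T, h⟩ := Im.exists_left R
    exact ((h.comp (Im.mk _)).le_iff ((Im.mk _).comp (h.tensor h))).2
      (CartesianBicategory.lax_copy T)
  lax_discard R := by
    obtain ⟨T, h⟩ := Im.exists_left R
    exact ((h.comp (Im.mk _)).le_iff (Im.mk _)).2 (CartesianBicategory.lax_discard T)

end

end Relations

end CartBicat

/-!
Every span is equivalent, for the covers given by regular epimorphisms, to its image: the regular
epimorphism from the apex of a span onto the apex of its image is a cover, and it witnesses both
inequalities (`JMSpan.image_le` and `JMSpan.le_image`, collected in `Relations.im_imageMap`).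
Between jointly monic spans, moreover, the order of `Span^S(C)` is already the existence of a
morphism of spans, because regular epimorphisms are orthogonal to monomorphisms (`JMSpan.le_iff`).
Hence regarding a jointly monic span as a span is an order isomorphism on each hom-poset, with
inverse the image.

The relation `Relations.Im R T`, saying that `R` in `Rel(C)` and `T` in `Span^S(C)` have a common
representative, is the graph of this bijection: it determines `R` (`Relations.Im.imageMap_eq`) and
`T` (`Relations.Im.inclusion_map`). It is compatible with identities, composition, tensor products
and graphs of isomorphisms, and holds between the corresponding structure maps of the (co)monoids
(`Relations.im_copy` and its companions), so both functors preserve all of the structure. They are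
the identity on objects, and both monoidal products are computed by the product of `C`, so unit and
tensorator can be taken to be identities. It follows that the composites are equal, and not merely
isomorphic, to the identity morphisms of cartesian bicategories (`CBFunctor.ext_of_eqToHom`).
-/

namespace CartBicat

/-! ### Equality of morphisms of cartesian bicategories -/

section Ext

open Functor.LaxMonoidal

variable {B₁ : Type u₁} [Category.{v₁} B₁] [MonoidalCategory B₁]
  {B₂ : Type u₂} [Category.{v₂} B₂] [MonoidalCategory B₂]

/-- A strong monoidal structure on a functor is determined by its unit and tensorator: the
oplax part consists of their inverses. -/
lemma monoidal_ext {F : B₁ ⥤ B₂} (M M' : F.Monoidal)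
    (hε : M.toLaxMonoidal.ε = M'.toLaxMonoidal.ε)
    (hμ : ∀ X Y, M.toLaxMonoidal.μ X Y = M'.toLaxMonoidal.μ X Y) : M = M' := by
  refine Functor.Monoidal.ext hε (funext₂ hμ) ?_ (funext₂ fun X Y => ?_)
  · have h₁ := M.η_ε
    have h₂ := M'.ε_η
    rw [← hε] at h₂
    calc M.η = M.η ≫ M.ε ≫ M'.η := by rw [h₂, Category.comp_id]
      _ = M'.η := by rw [← Category.assoc, h₁, Category.id_comp]
  · have h₁ := M.δ_μ X Y
    have h₂ := M'.μ_δ X Y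
    rw [← hμ] at h₂
    calc M.δ X Y = M.δ X Y ≫ M.μ X Y ≫ M'.δ X Y := by rw [h₂, Category.comp_id]
      _ = M'.δ X Y := by rw [← Category.assoc, h₁, Category.id_comp]

variable [CartesianBicategory B₁] [CartesianBicategory B₂]

/-- Two morphisms of cartesian bicategories with the same underlying functor are equal once their
units and tensorators agree. As the underlying functors are only assumed propositionally equal, the
structure maps are compared along `eqToHom`. -/
lemma CBFunctor.ext_of_eqToHom {F G : CBFunctor B₁ B₂} (h : F.toFunctor = G.toFunctor)
    (hε : ε F.toFunctor ≫ eqToHom (by rw [h]) = ε G.toFunctor)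
    (hμ : ∀ X Y, μ F.toFunctor X Y ≫ eqToHom (by rw [h]) =
      eqToHom (by rw [h]) ≫ μ G.toFunctor X Y) : F = G := by
  obtain @⟨F, @⟨M, _⟩, _, _, _, _, _⟩ := F
  obtain @⟨G, @⟨M', _⟩, _, _, _, _, _⟩ := G
  obtain rfl : F = G := h
  obtain rfl : M = M' :=
    monoidal_ext _ _ (by simpa using hε) (fun X Y => by simpa using hμ X Y)
  rfl

end Ext

/-! ### Inclusion of relations into spans, and images of spans -/

namespace Relations

variable {C : Type u} [Category.{v} C] [CartesianMonoidalCategory C] [Regular C]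

noncomputable section

/-- A relation corresponds to at most one morphism of `Span^S(C)`. -/
lemma Im.right_unique {X Y : Relations C} {R : X ⟶ Y} {T T' : toS X ⟶ toS Y}
    (h : Im R T) (h' : Im R T') : T = T' :=
  le_antisymm ((h.le_iff h').1 le_rfl) ((h'.le_iff h).1 le_rfl)

variable (C) in
/-- The functor `Rel(C) ⥤ Span^S(C)`, for `S` the class of regular epimorphisms, that regards a
jointly monic span as a span. -/
def inclusion : Relations C ⥤ SpanS (MorphismProperty.regularEpi C) where
  obj := toS
  map {X Y} := Quotient.map (sa := JMSpan.setoid X.as Y.as) (sb := Sp.setoid _ X.as Y.as)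
    JMSpan.toSpan fun s t h => ⟨(JMSpan.le_iff s t).1 h.1, (JMSpan.le_iff t s).1 h.2⟩
  map_id _ := rfl
  map_comp := by
    rintro X Y Z ⟨s⟩ ⟨t⟩
    exact JMSpan.mk_comp (X := toS X) (Y := toS Y) (Z := toS Z) s t

lemma im_inclusion {X Y : Relations C} (R : X ⟶ Y) : Im R ((inclusion C).map R) := by
  obtain ⟨s⟩ := R
  exact Im.mk s

lemma Im.inclusion_map {X Y : Relations C} {R : X ⟶ Y} {T : toS X ⟶ toS Y} (h : Im R T) :
    (inclusion C).map R = T :=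
  (im_inclusion R).right_unique h

lemma image_le_image {X Y : C} {s t : Sp X Y} (h : Sp.Le (MorphismProperty.regularEpi C) s t) :
    JMSpan.Le (JMSpan.image s) (JMSpan.image t) :=
  (JMSpan.le_iff _ _).2 ((JMSpan.image_le s).trans (h.trans (JMSpan.le_image t)))

/-- The relation represented by the image of a span. -/
def imageMap {X Y : SpanS (MorphismProperty.regularEpi C)} :
    (X ⟶ Y) → ((of X.as : Relations C) ⟶ of Y.as) :=
  Quotient.map (sa := Sp.setoid _ X.as Y.as) (sb := JMSpan.setoid X.as Y.as)
    JMSpan.image fun _ _ h => ⟨image_le_image h.1, image_le_image h.2⟩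

/-- A span and its image define the same morphism of `Span^S(C)`, because the comparison from
the apex of the span to the apex of its image is a regular epimorphism. -/
lemma im_imageMap {X Y : SpanS (MorphismProperty.regularEpi C)} (T : X ⟶ Y) :
    Im (imageMap T) T := by
  obtain ⟨s⟩ := T
  exact ⟨JMSpan.image s, rfl, Quotient.sound ⟨JMSpan.le_image s, JMSpan.image_le s⟩⟩

variable (C) in
/-- The functor `Span^S(C) ⥤ Rel(C)`, for `S` the class of regular epimorphisms, that sends a
span to its image. -/
def imageFunctor : SpanS (MorphismProperty.regularEpi C) ⥤ Relations C where
  obj X := of X.as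
  map := imageMap
  map_id X := (im_imageMap (𝟙 X)).ext (Im.id (of X.as)) rfl
  map_comp T T' := (im_imageMap (T ≫ T')).ext ((im_imageMap T).comp (im_imageMap T')) rfl

lemma Im.imageMap_eq {X Y : Relations C} {R : X ⟶ Y} {T : toS X ⟶ toS Y} (h : Im R T) :
    imageMap T = R :=
  (im_imageMap T).ext h rfl

lemma imageFunctor_comp_inclusion : imageFunctor C ⋙ inclusion C = 𝟭 _ :=
  Functor.hext (fun _ => rfl) fun _ _ T => heq_of_eq (im_imageMap T).inclusion_map

lemma inclusion_comp_imageFunctor : inclusion C ⋙ imageFunctor C = 𝟭 _ :=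
  Functor.hext (fun _ => rfl) fun _ _ R => heq_of_eq (im_inclusion R).imageMap_eq

/-! ### Monoidal structure of the two functors -/

/-- The functor `inclusion C` is strict monoidal: both tensor products are computed by
the product of `C`. -/
def inclusionCoreMonoidal : (inclusion C).CoreMonoidal where
  εIso := Iso.refl (𝟙_ (SpanS (MorphismProperty.regularEpi C)))
  μIso X Y := Iso.refl (toS X ⊗ toS Y)
  μIso_hom_natural_left R X' :=
    (Category.comp_id _).trans
      ((((im_inclusion R).tensor (Im.id X')).inclusion_map.symm).trans (Category.id_comp _).symm)
  μIso_hom_natural_right X' R :=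
    (Category.comp_id _).trans
      ((((Im.id X').tensor (im_inclusion R)).inclusion_map.symm).trans (Category.id_comp _).symm)
  associativity X Y Z := by
    change 𝟙 (toS X ⊗ toS Y) ▷ toS Z ≫ 𝟙 ((toS X ⊗ toS Y) ⊗ toS Z) ≫
        (α_ (toS X) (toS Y) (toS Z)).hom =
      (α_ (toS X) (toS Y) (toS Z)).hom ≫ toS X ◁ 𝟙 (toS Y ⊗ toS Z) ≫ 𝟙 (toS X ⊗ toS Y ⊗ toS Z)
    simp
  left_unitality X := by
    change (λ_ (toS X)).hom = 𝟙 (𝟙_ _) ▷ toS X ≫ 𝟙 (𝟙_ _ ⊗ toS X) ≫ (λ_ (toS X)).hom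
    simp
  right_unitality X := by
    change (ρ_ (toS X)).hom = toS X ◁ 𝟙 (𝟙_ _) ≫ 𝟙 (toS X ⊗ 𝟙_ _) ≫ (ρ_ (toS X)).hom
    simp

/-- The functor `imageFunctor C` is strict monoidal: both tensor products are computed by
the product of `C`. -/
def imageFunctorCoreMonoidal : (imageFunctor C).CoreMonoidal where
  εIso := Iso.refl (𝟙_ (Relations C))
  μIso X Y := Iso.refl (of X.as ⊗ of Y.as)
  μIso_hom_natural_left {X Y} T X' :=
    (Category.comp_id _).trans
      ((((im_imageMap T).tensor (Im.id (of X'.as))).imageMap_eq.symm).trans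
        (Category.id_comp _).symm)
  μIso_hom_natural_right X' T :=
    (Category.comp_id _).trans
      ((((Im.id (of X'.as)).tensor (im_imageMap T)).imageMap_eq.symm).trans
        (Category.id_comp _).symm)
  associativity X Y Z := by
    refine (congrArg (fun R => _ ≫ 𝟙 ((of X.as ⊗ of Y.as) ⊗ of Z.as) ≫ R)
      (Im.iso (α_ X.as Y.as Z.as)).imageMap_eq).trans ?_
    change 𝟙 (of X.as ⊗ of Y.as) ▷ of Z.as ≫ 𝟙 ((of X.as ⊗ of Y.as) ⊗ of Z.as) ≫
        (α_ (of X.as) (of Y.as) (of Z.as)).hom =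
      (α_ (of X.as) (of Y.as) (of Z.as)).hom ≫ of X.as ◁ 𝟙 (of Y.as ⊗ of Z.as) ≫
        𝟙 (of X.as ⊗ of Y.as ⊗ of Z.as)
    simp
  left_unitality X := by
    refine Eq.trans ?_ (congrArg (fun R => _ ≫ 𝟙 (𝟙_ (Relations C) ⊗ of X.as) ≫ R)
      (Im.iso (X := 𝟙_ (Relations C) ⊗ of X.as) (Y := of X.as) (λ_ X.as)).imageMap_eq.symm)
    change (λ_ (of X.as)).hom =
      𝟙 (𝟙_ _) ▷ of X.as ≫ 𝟙 (𝟙_ _ ⊗ of X.as) ≫ (λ_ (of X.as)).hom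
    simp
  right_unitality X := by
    refine Eq.trans ?_ (congrArg (fun R => _ ≫ 𝟙 (of X.as ⊗ 𝟙_ (Relations C)) ≫ R)
      (Im.iso (X := of X.as ⊗ 𝟙_ (Relations C)) (Y := of X.as) (ρ_ X.as)).imageMap_eq.symm)
    change (ρ_ (of X.as)).hom =
      of X.as ◁ 𝟙 (𝟙_ _) ≫ 𝟙 (of X.as ⊗ 𝟙_ _) ≫ (ρ_ (of X.as)).hom
    simp

instance : (inclusion C).Monoidal := inclusionCoreMonoidal.toMonoidal

instance : (imageFunctor C).Monoidal := imageFunctorCoreMonoidal.toMonoidal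

variable [BraidedCategory C]

instance : (inclusion C).Braided where
  braided _ _ := (Category.id_comp _).trans (Category.comp_id _).symm

instance : (imageFunctor C).Braided where
  braided X Y :=
    (Category.id_comp _).trans ((Im.iso (β_ X.as Y.as)).imageMap_eq.trans (Category.comp_id _).symm)

/-! ### The isomorphism of cartesian bicategories -/

variable (C) in
/-- The morphism of cartesian bicategories `Rel(C) ⟶ Span^S(C)` that regards a jointly monic span
as a span. -/
def inclusionCBFunctor : CBFunctor (Relations C) (SpanS (MorphismProperty.regularEpi C)) where
  toFunctor := inclusion C
  monotone {_ _ R T} h := ((im_inclusion R).le_iff (im_inclusion T)).1 h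
  map_copy _ := (Category.comp_id _).symm
  map_discard _ := (Category.comp_id _).symm
  map_cocopy _ := Category.id_comp _
  map_codiscard _ := Category.id_comp _

section

open ComonObj CartesianBicategory

variable (X : Relations C)

lemma im_copy : Im (comul (X := X)) (comul (X := toS X)) := Im.mk _

lemma im_discard : Im (counit (X := X)) (counit (X := toS X)) := Im.mk _

lemma im_cocopy : Im (cocopy X) (cocopy (toS X)) := Im.mk _

lemma im_codiscard : Im (codiscard X) (codiscard (toS X)) := Im.mk _

end

variable (C) in
/-- The morphism of cartesian bicategories `Span^S(C) ⟶ Rel(C)` that sends a span to its image. -/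
def imageCBFunctor : CBFunctor (SpanS (MorphismProperty.regularEpi C)) (Relations C) where
  toFunctor := imageFunctor C
  monotone {_ _ R T} h := ((im_imageMap R).le_iff (im_imageMap T)).2 h
  map_copy X := (im_copy (of X.as)).imageMap_eq.trans (Category.comp_id _).symm
  map_discard X := (im_discard (of X.as)).imageMap_eq.trans (Category.comp_id _).symm
  map_cocopy X := (Category.id_comp _).trans (im_cocopy (of X.as)).imageMap_eq
  map_codiscard X := (Category.id_comp _).trans (im_codiscard (of X.as)).imageMap_eq

variable (C) in
/-- Taking images and regarding jointly monic spans as spans are mutually inverse isomorphisms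
between `Span^S(C)` and `Rel(C)`, for `S` the class of regular epimorphisms. -/
def spanSIsoRelations : CBIso (SpanS (MorphismProperty.regularEpi C)) (Relations C) where
  hom := imageCBFunctor C
  inv := inclusionCBFunctor C
  -- Each composite has identities (or images of identities) as unit and tensorator, and the
  -- `eqToHom`s are identities because both functors are the identity on objects.
  hom_inv_id := by
    refine CBFunctor.ext_of_eqToHom imageFunctor_comp_inclusion ?_ fun X Y => ?_
    · exact (Category.comp_id _).trans ((Category.id_comp _).trans ((inclusion C).map_id (𝟙_ _)))
    · exact (Category.comp_id _).trans (((Category.id_comp _).trans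
        ((inclusion C).map_id (of X.as ⊗ of Y.as))).trans (Category.id_comp _).symm)
  inv_hom_id := by
    refine CBFunctor.ext_of_eqToHom inclusion_comp_imageFunctor ?_ fun X Y => ?_
    · exact (Category.comp_id _).trans ((Category.id_comp _).trans ((imageFunctor C).map_id (𝟙_ _)))
    · exact (Category.comp_id _).trans (((Category.id_comp _).trans
        ((imageFunctor C).map_id (toS X ⊗ toS Y))).trans (Category.id_comp _).symm)

end

end Relations

end CartBicat

theorem mainTheorem8 {C : Type u} [Category.{v} C] [Regular C]
    [CartesianMonoidalCategory C] [BraidedCategory C] :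
    Nonempty (CartBicat.CBIso (CartBicat.SpanS (MorphismProperty.regularEpi C))
      (CartBicat.Relations C)) :=
  ⟨CartBicat.Relations.spanSIsoRelations C⟩
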